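/- Let $M$ be a connected (Hausdorff, second countable, finite-dimensional) smooth manifold, and let $\pi : E_\pi \to M$ and $\eta : E_\eta \to M$ be two smooth real vector bundles of finite rank over $M$ (the ranks need not be equal). For a smooth vector bundle $\pi : E_\pi \to M$ and $k \in \mathbb{N}$, let ${\rm Pol}^k(\pi) \subset {\rm C}^\infty(E_\pi)$ be the space of smooth functions $E_\pi \to \mathbb{R}$ whose restriction to every fiber $\pi^{-1}(x)$, $x \in M$, is a homogeneous polynomial of degree $k$, and let ${\rm Pol}(\pi) = \bigoplus_{k \in \mathbb{N}} {\rm Pol}^k(\pi) \subset {\rm C}^\infty(E_\pi)$ be the $\mathbb{R}$-algebra of fiberwise polynomial functions. Then for any isomorphism of (unital) $\mathbb{R}$-algebras $\Psi : {\rm Pol}(\pi) \to {\rm Pol}(\eta)$ there is a unique homomorphism of (unital) $\mathbb{R}$-algebras $\bar{\Psi} : {\rm C}^\infty(E_\pi) \to {\rm C}^\infty(E_\eta)$ that extends $\Psi$, i.e. such that $\bar{\Psi}(f) = \Psi(f)$ for all $f \in {\rm Pol}(\pi)$. Moreover, $\bar{\Psi}$ is an isomorphism of $\mathbb{R}$-algebras.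 -/

import Mathlib

open scoped Manifold ContDiff Bundle

noncomputable section

namespace FiberwisePolynomial

/-- A real function `q` on a real vector space `V` is a homogeneous polynomial of degree `k` if it
is the restriction to the diagonal of a `k`-linear form. -/
def IsHomogeneousPolynomial {V : Type*} [AddCommGroup V] [Module ℝ V] (k : ℕ) (q : V → ℝ) : Prop :=
  ∃ p : MultilinearMap ℝ (fun _ : Fin k => V) ℝ, ∀ v : V, q v = p (fun _ => v)

theorem IsHomogeneousPolynomial.mul {V : Type*} [AddCommGroup V] [Module ℝ V] {k l : ℕ}
    {q r : V → ℝ} (hq : IsHomogeneousPolynomial k q) (hr : IsHomogeneousPolynomial l r) :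
    IsHomogeneousPolynomial (k + l) (fun v => q v * r v) := by
  obtain ⟨p, hp⟩ := hq
  obtain ⟨s, hs⟩ := hr
  refine ⟨((LinearMap.mul' ℝ ℝ).compMultilinearMap (p.domCoprod s)).domDomCongr finSumFinEquiv, ?_⟩
  intro v
  simp [hp, hs, MultilinearMap.domCoprod_apply]

variable (m : ℕ) {M : Type*} [TopologicalSpace M] [ChartedSpace (EuclideanSpace ℝ (Fin m)) M]
  (F : Type*) [NormedAddCommGroup F] [NormedSpace ℝ F]
  (E : M → Type*) [∀ x, AddCommGroup (E x)] [∀ x, Module ℝ (E x)]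
  [∀ x, TopologicalSpace (E x)] [TopologicalSpace (Bundle.TotalSpace F E)]
  [FiberBundle F E]

/-- The `ℝ`-algebra of smooth real functions on the total space of a vector bundle `E` with typical
fiber `F` over an `m`-dimensional manifold `M`. -/
abbrev SmoothFun : Type _ := C^∞⟮(𝓡 m).prod 𝓘(ℝ, F), Bundle.TotalSpace F E; ℝ⟯

/-- `Pol^k`: the smooth functions on the total space whose restriction to every fiber is a
homogeneous polynomial of degree `k`. -/
def PolHomogeneous (k : ℕ) : Submodule ℝ (SmoothFun m F E) where
  carrier := {f | ∀ x : M, IsHomogeneousPolynomial k (fun v : E x => f ⟨x, v⟩)}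
  zero_mem' x := ⟨0, fun v => by simp⟩
  add_mem' := by
    intro f g hf hg x
    obtain ⟨p, hp⟩ := hf x
    obtain ⟨s, hs⟩ := hg x
    refine ⟨p + s, fun v => ?_⟩
    have h1 := hp v
    have h2 := hs v
    simp only [add_apply, ContMDiffMap.coe_add, Pi.add_apply] at h1 h2 ⊢
    rw [h1, h2]
  smul_mem' := by
    intro c f hf x
    obtain ⟨p, hp⟩ := hf x
    refine ⟨c • p, fun v => ?_⟩
    have h1 := hp v
    simp only [smul_apply, ContMDiffMap.coe_smul, Pi.smul_apply] at h1 ⊢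
    rw [h1]

instance polHomogeneous_gradedMonoid : SetLike.GradedMonoid (PolHomogeneous m F E) where
  one_mem x := ⟨MultilinearMap.constOfIsEmpty ℝ _ 1, fun v => by simp⟩
  mul_mem := by
    intro k l f g hf hg x
    exact (hf x).mul (hg x)

/-- `Pol = ⨁ₖ Pol^k`: the algebra of fiberwise polynomial functions, i.e. of the finite sums of
smooth fiberwise homogeneous polynomial functions, as a subalgebra of the algebra of smooth
functions on the total space. -/
def Pol : Subalgebra ℝ (SmoothFun m F E) :=
  (⨆ k : ℕ, PolHomogeneous m F E k).toSubalgebra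
    (Submodule.mem_iSup_of_mem 0 (SetLike.GradedOne.one_mem (A := PolHomogeneous m F E)))
    (by
      intro f g hf hg
      induction hf using Submodule.iSup_induction' with
      | mem k f hf =>
        induction hg using Submodule.iSup_induction' with
        | mem l g hg => exact Submodule.mem_iSup_of_mem (k + l) (SetLike.mul_mem_graded hf hg)
        | zero => simp
        | add g₁ g₂ _ _ h₁ h₂ => rw [mul_add]; exact add_mem h₁ h₂
      | zero => simp
      | add f₁ f₂ _ _ h₁ h₂ => rw [add_mul]; exact add_mem h₁ h₂)

end FiberwisePolynomial

end

/-!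
A homomorphism from `Pol` to smooth functions on a manifold `N` is the pullback along a smooth map
from `N` to the total space, so it extends to all smooth functions.

The points of the total space are exactly the characters of `Pol` (`exists_eq_eval_of_Pol`). A
character restricts to a character of the algebra of smooth functions on the base, which by the
classical compactness argument is the evaluation at some `x` (`exists_eq_evalAt`). Its values on the
fiberwise linear functions `Cutoff.fiberCoord` form a linear functional on the dual of the typical
fiber, hence a vector `w`. Near `x`, functions on the base and linear fiber coordinates generate
`Pol` (`Cutoff.pow_mul_mem_of_generators_mem`), so the character is the evaluation at the point
with coordinates `(x, w)`. For the smoothness of the coefficients involved, homogeneous polynomials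
of fixed degree on the typical fiber are written as linear combinations of fixed polynomials whose
coefficients are fixed linear combinations of finitely many values (`exists_sampling`).

Given a homomorphism `Ψ` out of `Pol`, composing `Ψ` with evaluations at points of `N` thus gives a
map `φ` with `Ψ f = f ∘ φ`, and `φ` is smooth because `Pol` contains enough local coordinates
(`contMDiff_of_forall_Pol`). Pullback along `φ` is the extension (`exists_algHom_extension`).

For uniqueness, a character of all smooth functions that agrees with the evaluation at `q` on `Pol`
is that evaluation (`eq_evalAt_of_eq_on_Pol`): `Pol` contains a nonnegative function whose only zero
is `q`, and if some `f` had a value under the character other than `f q`, adding this function to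
the square of `f` minus that value would give an invertible function in the kernel. Bijectivity
follows, as the extensions of `Ψ` and of its inverse are mutually inverse by uniqueness.
-/

noncomputable section

namespace FiberwisePolynomial

/-! ### Characters of algebras of smooth functions -/

section Characters

variable {V : Type*} [NormedAddCommGroup V] [NormedSpace ℝ V]
  {H : Type*} [TopologicalSpace H] {I : ModelWithCorners ℝ V H}
  {N : Type*} [TopologicalSpace N] [ChartedSpace H N]
  {V' : Type*} [NormedAddCommGroup V'] [NormedSpace ℝ V']
  {H' : Type*} [TopologicalSpace H'] {I' : ModelWithCorners ℝ V' H'}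
  {N' : Type*} [TopologicalSpace N'] [ChartedSpace H' N']

/-- Precomposition with a smooth map, as a homomorphism of algebras of smooth functions. -/
def precomp (h : C^∞⟮I, N; I', N'⟯) : C^∞⟮I', N'; ℝ⟯ →ₐ[ℝ] C^∞⟮I, N; ℝ⟯ where
  toFun f := f.comp h
  map_one' := rfl
  map_mul' _ _ := rfl
  map_zero' := rfl
  map_add' _ _ := rfl
  commutes' _ := rfl

@[simp] theorem precomp_apply (h : C^∞⟮I, N; I', N'⟯) (f : C^∞⟮I', N'; ℝ⟯) (x : N) :
    precomp h f x = f (h x) := rfl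

/-- Evaluation at a point, as a character of the algebra of smooth functions. -/
def evalAt (I : ModelWithCorners ℝ V H) (x : N) : C^∞⟮I, N; ℝ⟯ →ₐ[ℝ] ℝ where
  toFun f := f x
  map_one' := rfl
  map_mul' _ _ := rfl
  map_zero' := rfl
  map_add' _ _ := rfl
  commutes' _ := rfl

@[simp] theorem evalAt_apply (x : N) (f : C^∞⟮I, N; ℝ⟯) : evalAt I x f = f x := rfl

/-- A smooth function without zeros is invertible, so a function killed by a character has a
zero. -/
theorem exists_zero_of_map_eq_zero (χ : C^∞⟮I, N; ℝ⟯ →ₐ[ℝ] ℝ) {f : C^∞⟮I, N; ℝ⟯}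
    (hf : χ f = 0) : ∃ x, f x = 0 := by
  by_contra! h
  let g : C^∞⟮I, N; ℝ⟯ := ⟨fun x => (f x)⁻¹, f.contMDiff.inv₀ h⟩
  have hfg : f * g = 1 := by
    ext x
    exact mul_inv_cancel₀ (h x)
  have := congrArg χ hfg
  simp [hf] at this

/-- A σ-compact manifold carries a smooth function with compact sublevel sets. -/
theorem exists_contMDiffMap_isCompact_sublevel (I : ModelWithCorners ℝ V H)
    [FiniteDimensional ℝ V] [IsManifold I ∞ N] [T2Space N] [SigmaCompactSpace N] :
    ∃ ρ : C^∞⟮I, N; ℝ⟯, ∀ c : ℝ, IsCompact {x | ρ x ≤ c} := by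
  have : LocallyCompactSpace H := I.locallyCompactSpace
  have : LocallyCompactSpace N := ChartedSpace.locallyCompactSpace H N
  let K : CompactExhaustion N := default
  obtain ⟨ρ, hρ⟩ := exists_contMDiffMap_forall_mem_convex_of_local_const I (n := ⊤)
    (t := fun x : N => Set.Ici (K.find x : ℝ)) (fun x => convex_Ici _) (by
      intro x
      refine ⟨(K.find x + 1 : ℕ), ?_⟩
      have hx : x ∈ interior (K (K.find x + 1)) :=
        K.subset_interior_succ _ (K.mem_find x)
      filter_upwards [isOpen_interior.mem_nhds hx] with y hy
      have := (K.mem_iff_find_le).1 (interior_subset hy)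
      exact Set.mem_Ici.2 (by exact_mod_cast this))
  refine ⟨ρ, fun c => ?_⟩
  refine (K.isCompact ⌈c⌉₊).of_isClosed_subset
    (isClosed_le ρ.contMDiff.continuous continuous_const) fun x hx => ?_
  rw [K.mem_iff_find_le]
  have h1 : (K.find x : ℝ) ≤ ρ x := hρ x
  have h2 : (K.find x : ℝ) ≤ (⌈c⌉₊ : ℝ) := (h1.trans hx).trans (Nat.le_ceil c)
  exact_mod_cast h2

/-- Every character of the algebra of smooth functions on a σ-compact manifold is the evaluation at
a point. -/
theorem exists_eq_evalAt [FiniteDimensional ℝ V] [IsManifold I ∞ N] [T2Space N]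
    [SigmaCompactSpace N] (χ : C^∞⟮I, N; ℝ⟯ →ₐ[ℝ] ℝ) : ∃ x, χ = evalAt I x := by
  by_contra! hχ
  have hχ' : ∀ x, ∃ f : C^∞⟮I, N; ℝ⟯, χ f = 0 ∧ f x ≠ 0 := by
    intro x
    obtain ⟨f, hf⟩ := DFunLike.ne_iff.1 (hχ x)
    refine ⟨f - algebraMap ℝ _ (χ f), by simp, ?_⟩
    have : f x - χ f ≠ 0 := sub_ne_zero.2 (Ne.symm hf)
    exact this
  choose f hf hfx using hχ'
  obtain ⟨ρ, hρ⟩ := exists_contMDiffMap_isCompact_sublevel (N := N) I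
  obtain ⟨t, -, ht⟩ := (hρ (χ ρ)).elim_nhds_subcover (fun x => {y | f x y ≠ 0}) fun x _ =>
    (isOpen_ne_fun (f x).contMDiff.continuous continuous_const).mem_nhds (hfx x)
  -- This sum of squares is killed by `χ`, but its first term is nonzero off the compact sublevel
  -- set, on which one of the other terms is nonzero.
  obtain ⟨y, hy⟩ := exists_zero_of_map_eq_zero χ
    (f := (ρ - algebraMap ℝ _ (χ ρ)) ^ 2 + ∑ x ∈ t, f x ^ 2) (by simp [hf])
  have hy' : (ρ y - χ ρ) ^ 2 + ∑ x ∈ t, f x y ^ 2 = 0 := by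
    rw [← evalAt_apply (I := I)] at hy
    simpa only [map_add, map_sum, map_pow, map_sub, AlgHom.commutes, evalAt_apply,
      Algebra.algebraMap_self, RingHom.id_apply] using hy
  have hs : 0 ≤ ∑ x ∈ t, f x y ^ 2 := Finset.sum_nonneg fun _ _ => sq_nonneg _
  have h1 : (ρ y - χ ρ) ^ 2 = 0 := le_antisymm (by linarith) (sq_nonneg _)
  have h2 : ∑ x ∈ t, f x y ^ 2 = 0 := by linarith
  rw [Finset.sum_eq_zero_iff_of_nonneg fun _ _ => sq_nonneg _] at h2
  have h3 : y ∈ {x | ρ x ≤ χ ρ} := (sub_eq_zero.1 (pow_eq_zero_iff two_ne_zero |>.1 h1)).le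
  obtain ⟨x, hx, hxy⟩ := Set.mem_iUnion₂.1 (ht h3)
  exact hxy (pow_eq_zero_iff two_ne_zero |>.1 (h2 x hx))

/-- A map into a finite-dimensional vector space is smooth if its composition with every linear
form is. -/
theorem contMDiffAt_of_forall_clm [FiniteDimensional ℝ V'] {g : N → V'} {x : N}
    (h : ∀ l : V' →L[ℝ] ℝ, ContMDiffAt I 𝓘(ℝ, ℝ) ∞ (fun y => l (g y)) x) :
    ContMDiffAt I 𝓘(ℝ, V') ∞ g x := by
  let β := Module.finBasis ℝ V'
  have : g = fun y => ∑ i, (LinearMap.toContinuousLinearMap (β.coord i)) (g y) • β i := by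
    funext y
    simp [β.sum_repr]
  rw [this]
  exact contMDiffAt_finsetSum fun i _ => (h _).smul contMDiffAt_const

end Characters

/-! ### Homogeneous polynomials on finite-dimensional spaces -/

section HomogeneousPolynomials

/-- An element of a finite-dimensional space `S` of functions depends linearly on finitely many of
its values. -/
theorem exists_sampling {X : Type*} (S : Submodule ℝ (X → ℝ)) [FiniteDimensional ℝ S] :
    ∃ (n : ℕ) (p : Fin n → X → ℝ) (c : Fin n → X →₀ ℝ), (∀ i, p i ∈ S) ∧
      ∀ g ∈ S, ∀ x, g x = ∑ i, ((c i).sum fun y r => r * g y) * p i x := by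
  let ev : X → Module.Dual ℝ S := fun x => (LinearMap.proj x).comp S.subtype
  have hspan : Submodule.span ℝ (Set.range ev) = ⊤ := by
    by_contra h
    -- A linear form on the dual of `S` is the evaluation at some `g ∈ S`; if it kills all point
    -- evaluations, then `g` vanishes identically.
    obtain ⟨θ, hθ, hle⟩ := Submodule.exists_le_ker_of_lt_top _ (lt_top_iff_ne_top.2 h)
    obtain ⟨g, rfl⟩ := (Module.evalEquiv ℝ S).surjective θ
    apply hθ
    have hg : g = 0 := by
      ext x
      exact hle (Submodule.subset_span (Set.mem_range_self x))
    simp [hg]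
  let β := Module.finBasis ℝ S
  have hc : ∀ i, ∃ c : X →₀ ℝ, (c.sum fun x r => r • ev x) = β.coord i := fun i =>
    Finsupp.mem_span_range_iff_exists_finsupp.1 (hspan ▸ Submodule.mem_top)
  choose c hc using hc
  refine ⟨_, fun i => (β i : X → ℝ), c, fun i => (β i).2, fun g hg x => ?_⟩
  have h1 : ∀ i, ((c i).sum fun y r => r * g y) = β.repr ⟨g, hg⟩ i := by
    intro i
    have := congrArg (fun θ : Module.Dual ℝ S => θ ⟨g, hg⟩) (hc i)
    simpa [Finsupp.sum, LinearMap.sum_apply, ev] using this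
  have h2 := congrArg (fun s : S => (s : X → ℝ) x) (β.sum_repr ⟨g, hg⟩)
  simp only [Submodule.coe_sum, Finset.sum_apply, Submodule.coe_smul, Pi.smul_apply,
    smul_eq_mul] at h2
  simp only [h1, h2]

/-- Homogeneous polynomials of a fixed degree on a vector space, as a space of functions: the range
of restriction to the diagonal on multilinear forms. -/
def homogeneousPolynomials (V : Type*) [AddCommGroup V] [Module ℝ V] (k : ℕ) :
    Submodule ℝ (V → ℝ) :=
  LinearMap.range (M₂ := V → ℝ)
    ({ toFun := fun p v => p fun _ => v
       map_add' := fun _ _ => rfl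
       map_smul' := fun _ _ => rfl } : MultilinearMap ℝ (fun _ : Fin k => V) ℝ →ₗ[ℝ] V → ℝ)

theorem mem_homogeneousPolynomials {V : Type*} [AddCommGroup V] [Module ℝ V] {k : ℕ}
    {q : V → ℝ} : q ∈ homogeneousPolynomials V k ↔ IsHomogeneousPolynomial k q := by
  simp only [homogeneousPolynomials, LinearMap.mem_range, IsHomogeneousPolynomial, funext_iff]
  exact exists_congr fun p => forall_congr' fun v => eq_comm

instance {V : Type*} [AddCommGroup V] [Module ℝ V] [FiniteDimensional ℝ V] (k : ℕ) :
    FiniteDimensional ℝ (homogeneousPolynomials V k) := by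
  unfold homogeneousPolynomials
  infer_instance

/-- Expansion of a homogeneous polynomial into monomials in the coordinates. -/
theorem IsHomogeneousPolynomial.exists_expansion {V ι : Type*} [AddCommGroup V] [Module ℝ V]
    [Fintype ι] (β : Module.Basis ι ℝ V) {k : ℕ} {q : V → ℝ} (hq : IsHomogeneousPolynomial k q) :
    ∃ c : (Fin k → ι) → ℝ, ∀ v, q v = ∑ r, c r * ∏ j, β.coord (r j) v := by
  classical
  obtain ⟨p, hp⟩ := hq
  refine ⟨fun r => p fun j => β (r j), fun v => ?_⟩
  rw [hp]
  conv_lhs => rw [← β.sum_repr v]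
  rw [p.map_sum]
  refine Finset.sum_congr rfl fun r _ => ?_
  rw [p.map_smul_univ, smul_eq_mul, mul_comm]
  rfl

theorem IsHomogeneousPolynomial.comp_linearMap {V W : Type*} [AddCommGroup V] [Module ℝ V]
    [AddCommGroup W] [Module ℝ W] {k : ℕ} {q : V → ℝ} (hq : IsHomogeneousPolynomial k q)
    (l : W →ₗ[ℝ] V) : IsHomogeneousPolynomial k fun w => q (l w) := by
  obtain ⟨p, hp⟩ := hq
  exact ⟨p.compLinearMap fun _ => l, fun w => hp _⟩

end HomogeneousPolynomials

/-! ### Fiberwise polynomial functions in a trivialization -/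

section Bundle

open Bundle Topology

variable {m : ℕ} {M : Type*} [TopologicalSpace M]
  [ChartedSpace (EuclideanSpace ℝ (Fin m)) M]
  {F : Type*} [NormedAddCommGroup F]
  {E : M → Type*} [∀ x, TopologicalSpace (E x)] [TopologicalSpace (TotalSpace F E)]
  [FiberBundle F E]

variable (F E) in
/-- A smooth cutoff function at `x` for the vector bundle `E`: a smooth function on the base that
is `1` near `x` and is supported in the base set of the preferred trivialization at `x`. -/
structure Cutoff (x : M) where
  /-- the underlying smooth function -/
  toFun : C^∞⟮𝓡 m, M; ℝ⟯
  eventually_eq_one : ∀ᶠ y in 𝓝 x, toFun y = 1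
  tsupport_subset : tsupport toFun ⊆ (trivializationAt F E x).baseSet

namespace Cutoff

variable {x : M} (b : Cutoff (m := m) F E x)

theorem eq_one : b.toFun x = 1 := b.eventually_eq_one.self_of_nhds

theorem mem_baseSet {y : M} (hy : b.toFun y ≠ 0) : y ∈ (trivializationAt F E x).baseSet :=
  b.tsupport_subset (subset_tsupport _ hy)

variable (F E) in
theorem nonempty [T2Space M] [IsManifold (𝓡 m) ∞ M] (x : M) :
    Nonempty (Cutoff (m := m) F E x) := by
  obtain ⟨f, -, hf⟩ := (SmoothBumpFunction.nhds_basis_tsupport (I := 𝓡 m) x).mem_iff.1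
    ((trivializationAt F E x).open_baseSet.mem_nhds (mem_baseSet_trivializationAt F E x))
  exact ⟨⟨f, f.contMDiff⟩, f.eventuallyEq_one, hf⟩

end Cutoff

variable [NormedSpace ℝ F]

variable (m F E) in
/-- The bundle projection as a smooth map. -/
def projMap : C^∞⟮(𝓡 m).prod 𝓘(ℝ, F), TotalSpace F E; 𝓡 m, M⟯ :=
  ⟨TotalSpace.proj, contMDiff_proj E⟩

@[simp] theorem projMap_apply (p : TotalSpace F E) : projMap m F E p = p.proj := rfl

variable [∀ x, AddCommGroup (E x)] [∀ x, Module ℝ (E x)]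

theorem mem_Pol_of_mem_PolHomogeneous {k : ℕ} {f : SmoothFun m F E}
    (hf : f ∈ PolHomogeneous m F E k) : f ∈ Pol m F E :=
  Submodule.mem_iSup_of_mem k hf

theorem precomp_projMap_mem (a : C^∞⟮𝓡 m, M; ℝ⟯) :
    precomp (projMap m F E) a ∈ PolHomogeneous m F E 0 := fun x =>
  ⟨MultilinearMap.constOfIsEmpty ℝ _ (a x), fun v => by simp⟩

namespace Cutoff

variable {x : M} (b : Cutoff (m := m) F E x)

variable [VectorBundle ℝ F E] [ContMDiffVectorBundle ∞ F E (𝓡 m)]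

/-- The fiberwise linear function which, on the domain of a trivialization, is the linear form `l`
in the fiber coordinate, multiplied by a cutoff function on the base. -/
def fiberCoord (l : F →L[ℝ] ℝ) : SmoothFun m F E :=
  ⟨fun p => b.toFun p.proj * l (trivializationAt F E x p).2, by
    intro p
    by_cases hp : p.proj ∈ tsupport b.toFun
    · have hs : p ∈ (trivializationAt F E x).source :=
        (trivializationAt F E x).mem_source.2 (b.tsupport_subset hp)
      have h1 := ((trivializationAt F E x).contMDiffAt_iff (n := ∞) (IB := 𝓡 m)
        (IM := (𝓡 m).prod 𝓘(ℝ, F)) (f := id) hs).1 contMDiffAt_id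
      exact (b.toFun.contMDiff.contMDiffAt.comp p h1.1).mul
        (l.contMDiff.contMDiffAt.comp p h1.2)
    · have h0 : ∀ᶠ q : TotalSpace F E in 𝓝 p, b.toFun q.proj = 0 :=
        (FiberBundle.continuous_proj F E).continuousAt.eventually
          (notMem_tsupport_iff_eventuallyEq.1 hp)
      refine (contMDiffAt_const (c := (0 : ℝ))).congr_of_eventuallyEq ?_
      filter_upwards [h0] with q hq
      simp [hq]⟩

theorem fiberCoord_apply (l : F →L[ℝ] ℝ) (p : TotalSpace F E) :
    b.fiberCoord l p = b.toFun p.proj * l (trivializationAt F E x p).2 := rfl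

theorem fiberCoord_mem (l : F →L[ℝ] ℝ) : b.fiberCoord l ∈ PolHomogeneous m F E 1 := by
  intro y
  by_cases hy : b.toFun y = 0
  · exact ⟨0, fun v => by simp [fiberCoord_apply, hy]⟩
  · let L : E y →ₗ[ℝ] ℝ :=
      b.toFun y • l.toLinearMap.comp ((trivializationAt F E x).linearMapAt ℝ y)
    refine ⟨LinearMap.compMultilinearMap L (MultilinearMap.ofSubsingleton ℝ (E y) (E y) 0
      LinearMap.id), fun v => ?_⟩
    simp [fiberCoord_apply, L, b.mem_baseSet hy]

/-- The values of a smooth function on the total space along a local section that is constant in the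
trivialization, cut off to a smooth function on the base. -/
def valueAlong (f : SmoothFun m F E) (w : F) : C^∞⟮𝓡 m, M; ℝ⟯ :=
  ⟨fun y => b.toFun y * f ⟨y, (trivializationAt F E x).symm y w⟩, by
    refine contMDiff_of_tsupport fun y hy => ?_
    have hy' : y ∈ (trivializationAt F E x).baseSet :=
      b.tsupport_subset (closure_mono (Function.support_mul_subset_left _ _) hy)
    refine b.toFun.contMDiff.contMDiffAt.mul (f.contMDiff.contMDiffAt.comp y ?_)
    rw [(trivializationAt F E x).contMDiffAt_iff
      ((trivializationAt F E x).mem_source.2 hy')]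
    refine ⟨contMDiffAt_id, (contMDiffAt_const (c := w)).congr_of_eventuallyEq ?_⟩
    filter_upwards [(trivializationAt F E x).open_baseSet.mem_nhds hy'] with z hz
    rw [Trivialization.apply_mk_symm _ hz]⟩

theorem valueAlong_apply (f : SmoothFun m F E) (w : F) (y : M) :
    b.valueAlong f w y = b.toFun y * f ⟨y, (trivializationAt F E x).symm y w⟩ := rfl

/-- Over the domain of a trivialization, the algebra `Pol` is generated by functions on the base and
the linear fiber coordinates. The coefficients are smooth because a polynomial on the typical fiber
of degree `k` is a combination of fixed polynomials, with coefficients that depend linearly on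
finitely many of its values. Of the `k + 1` factors of the cutoff, one makes these coefficients
globally defined, and one is contained in each of the `k` fiber coordinates of a monomial. -/
theorem pow_mul_mem_of_generators_mem [FiniteDimensional ℝ F] {A : Subalgebra ℝ (SmoothFun m F E)}
    (hA : ∀ a, precomp (projMap m F E) a ∈ A) (hb : ∀ l, b.fiberCoord l ∈ A)
    {k : ℕ} {f : SmoothFun m F E} (hf : f ∈ PolHomogeneous m F E k) :
    precomp (projMap m F E) b.toFun ^ (k + 1) * f ∈ A := by
  obtain ⟨n, p, c, hp, hc⟩ := exists_sampling (homogeneousPolynomials F k)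
  let β := Module.finBasis ℝ F
  choose d hd using fun i => (mem_homogeneousPolynomials.1 (hp i)).exists_expansion β
  have key : precomp (projMap m F E) b.toFun ^ (k + 1) * f =
      ∑ i, precomp (projMap m F E) (∑ w ∈ (c i).support, c i w • b.valueAlong f w) *
        ∑ r, d i r •
          ∏ j : Fin k, b.fiberCoord (LinearMap.toContinuousLinearMap (β.coord (r j))) := by
    ext q
    simp only [← evalAt_apply (I := (𝓡 m).prod 𝓘(ℝ, F)) q, map_sum, map_mul, map_pow, map_smul,
      map_prod]
    simp only [evalAt_apply, precomp_apply, projMap_apply, valueAlong_apply, fiberCoord_apply,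
      smul_eq_mul, LinearMap.coe_toContinuousLinearMap']
    by_cases hq : b.toFun q.proj = 0
    · simp [hq]
    obtain ⟨y, v⟩ := q
    have hy := b.mem_baseSet hq
    set e := trivializationAt F E x
    have hmem : (fun w => f ⟨y, e.symm y w⟩) ∈ homogeneousPolynomials F k := by
      rw [mem_homogeneousPolynomials, ← Trivialization.coe_symmₗ (R := ℝ) e hy]
      exact (hf y).comp_linearMap (e.symmₗ ℝ y)
    have h1 := hc _ hmem (e ⟨y, v⟩).2
    simp only [hd, Finsupp.sum] at h1
    rw [Trivialization.symm_apply_apply_mk e hy v] at h1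
    rw [h1, Finset.mul_sum]
    refine Finset.sum_congr rfl fun i _ => ?_
    simp only [Finset.prod_mul_distrib, Finset.prod_const, Finset.card_univ, Fintype.card_fin]
    simp only [mul_left_comm _ (b.toFun y), ← Finset.mul_sum, mul_left_comm _ (b.toFun y ^ k)]
    ring
  rw [key]
  exact sum_mem fun i _ => mul_mem (hA _)
    (sum_mem fun r _ => A.smul_mem (prod_mem fun j _ => hb _) _)

end Cutoff

end Bundle

/-! ### Points of the total space as characters -/

section Points

open Bundle Topology

variable {m : ℕ} {M : Type*} [TopologicalSpace M] [T2Space M]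
  [ChartedSpace (EuclideanSpace ℝ (Fin m)) M] [IsManifold (𝓡 m) ∞ M]
  {F : Type*} [NormedAddCommGroup F] [NormedSpace ℝ F]
  {E : M → Type*} [∀ x, AddCommGroup (E x)] [∀ x, Module ℝ (E x)]
  [∀ x, TopologicalSpace (E x)] [TopologicalSpace (TotalSpace F E)]
  [FiberBundle F E] [VectorBundle ℝ F E] [ContMDiffVectorBundle ∞ F E (𝓡 m)]

/-- Every character of `Pol` is the evaluation at a point of the total space. Its restriction to
functions on the base gives the base point, its values on linear fiber coordinates give a vector in
the fiber, and these data determine it because they determine it on generators. -/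
theorem exists_eq_eval_of_Pol [SecondCountableTopology M] [FiniteDimensional ℝ F]
    (χ : Pol m F E →ₐ[ℝ] ℝ) :
    ∃ q : TotalSpace F E, ∀ f : Pol m F E, χ f = (f : SmoothFun m F E) q := by
  have : LocallyCompactSpace M := ChartedSpace.locallyCompactSpace (EuclideanSpace ℝ (Fin m)) M
  let P : C^∞⟮𝓡 m, M; ℝ⟯ →ₐ[ℝ] Pol m F E := (precomp (projMap m F E)).codRestrict _
    fun a => mem_Pol_of_mem_PolHomogeneous (precomp_projMap_mem a)
  obtain ⟨x, hx⟩ := exists_eq_evalAt (χ.comp P)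
  obtain ⟨b⟩ := Cutoff.nonempty (m := m) F E x
  let T (l : F →L[ℝ] ℝ) : Pol m F E :=
    ⟨b.fiberCoord l, mem_Pol_of_mem_PolHomogeneous (b.fiberCoord_mem l)⟩
  let θ : Module.Dual ℝ (Module.Dual ℝ F) :=
    { toFun := fun l => χ (T (LinearMap.toContinuousLinearMap l))
      map_add' := fun l l' => by
        rw [← map_add]
        congr 1
        ext p
        exact mul_add _ _ _
      map_smul' := fun r l => by
        rw [RingHom.id_apply, ← map_smul]
        congr 1
        ext p
        exact mul_left_comm _ _ _ }
  let w : F := (Module.evalEquiv ℝ F).symm θ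
  have hw : ∀ l : F →L[ℝ] ℝ, χ (T l) = l w := fun l => by
    have h := Module.apply_evalEquiv_symm_apply (R := ℝ) (f := (l : Module.Dual ℝ F)) (g := θ)
    exact h.symm
  set e := trivializationAt F E x
  have hxe : x ∈ e.baseSet := mem_baseSet_trivializationAt F E x
  let q : TotalSpace F E := ⟨x, e.symm x w⟩
  let ev : Pol m F E →ₐ[ℝ] ℝ := (evalAt _ q).comp (Pol m F E).val
  have hP : ∀ a, χ (P a) = ev (P a) := fun a => DFunLike.congr_fun hx a
  have hT : ∀ l, χ (T l) = ev (T l) := fun l => by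
    have : ev (T l) = b.toFun x * l (e ⟨x, e.symm x w⟩).2 := rfl
    rw [hw, this, b.eq_one, one_mul, Trivialization.apply_mk_symm _ hxe]
  have hhom : ∀ k, ∀ f : Pol m F E, (f : SmoothFun m F E) ∈ PolHomogeneous m F E k →
      χ f = ev f := by
    intro k f hf
    have hmem := b.pow_mul_mem_of_generators_mem
      (A := (AlgHom.equalizer χ ev).map (Pol m F E).val)
      (fun a => ⟨P a, hP a, rfl⟩) (fun l => ⟨T l, hT l, rfl⟩) hf
    obtain ⟨g, hg, hgf⟩ := hmem
    have hgf' : g = P b.toFun ^ (k + 1) * f := Subtype.ext hgf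
    have h1 : ev (P b.toFun) = 1 := b.eq_one
    have h2 : χ g = ev g := hg
    simpa [hgf', hP, h1] using h2
  refine ⟨q, fun f => ?_⟩
  change χ f = ev f
  obtain ⟨f, hf⟩ := f
  have hf' : f ∈ ⨆ k, PolHomogeneous m F E k := hf
  induction hf' using Submodule.iSup_induction' with
  | mem k f hfk => exact hhom k _ hfk
  | zero => exact (map_zero χ).trans (map_zero ev).symm
  | add f g hf' hg' h1 h2 =>
    exact (map_add χ ⟨f, hf'⟩ ⟨g, hg'⟩).trans <|
      (congrArg₂ (· + ·) (h1 hf') (h2 hg')).trans (map_add ev ⟨f, hf'⟩ ⟨g, hg'⟩).symm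

variable (m) in
/-- A fiberwise polynomial function can be nonnegative with a single prescribed zero. -/
theorem exists_Pol_nonneg_eq_zero_iff [SecondCountableTopology M] [FiniteDimensional ℝ F]
    (q : TotalSpace F E) :
    ∃ ρ : Pol m F E, ∀ p, 0 ≤ (ρ : SmoothFun m F E) p ∧
      ((ρ : SmoothFun m F E) p = 0 ↔ p = q) := by
  have : LocallyCompactSpace M := ChartedSpace.locallyCompactSpace (EuclideanSpace ℝ (Fin m)) M
  obtain ⟨a, ha, har, ha0, -⟩ := exists_contMDiff_zero_iff_one_iff_of_isClosed (𝓡 m) (n := ⊤)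
    (isClosed_singleton (x := q.proj)) isClosed_empty (Set.disjoint_empty _)
  obtain ⟨b⟩ := Cutoff.nonempty (m := m) F E q.proj
  let β := Module.finBasis ℝ F
  let l i : F →L[ℝ] ℝ := LinearMap.toContinuousLinearMap (β.coord i)
  set e := trivializationAt F E q.proj
  let ρ : SmoothFun m F E := precomp (projMap m F E) ⟨a, ha⟩ +
    ∑ i, (b.fiberCoord (l i) - algebraMap ℝ _ (l i (e q).2)) ^ 2
  have hρ : ρ ∈ Pol m F E := add_mem (mem_Pol_of_mem_PolHomogeneous (precomp_projMap_mem _)) <|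
    sum_mem fun i _ => pow_mem (sub_mem (mem_Pol_of_mem_PolHomogeneous (b.fiberCoord_mem _))
      (Subalgebra.algebraMap_mem _ _)) 2
  have hρa : ∀ p, ρ p = a p.proj + ∑ i, (b.toFun p.proj * l i (e p).2 - l i (e q).2) ^ 2 := by
    intro p
    rw [← evalAt_apply (I := (𝓡 m).prod 𝓘(ℝ, F)) p]
    simp only [ρ, map_add, map_sum, map_pow, map_sub, AlgHom.commutes, evalAt_apply,
      Algebra.algebraMap_self, RingHom.id_apply]
    rfl
  have ha_nonneg : ∀ y, 0 ≤ a y := fun y => (har ⟨y, rfl⟩).1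
  have hs_nonneg : ∀ p, 0 ≤ ∑ i, (b.toFun (TotalSpace.proj p) * l i (e p).2 - l i (e q).2) ^ 2 :=
    fun p => Finset.sum_nonneg fun _ _ => sq_nonneg _
  refine ⟨⟨ρ, hρ⟩, fun p => ⟨?_, fun hp => ?_, ?_⟩⟩
  · exact (hρa p).symm ▸ add_nonneg (ha_nonneg _) (hs_nonneg p)
  · change ρ p = 0 at hp
    rw [hρa] at hp
    obtain ⟨h1, h2⟩ := (add_eq_zero_iff_of_nonneg (ha_nonneg _) (hs_nonneg p)).1 hp
    have hpq : p.proj = q.proj := (ha0 _).2 h1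
    rw [Finset.sum_eq_zero_iff_of_nonneg fun _ _ => sq_nonneg _] at h2
    have hqs : q ∈ e.source := e.mem_source.2 (mem_baseSet_trivializationAt F E q.proj)
    have hps : p ∈ e.source := e.mem_source.2 (hpq ▸ mem_baseSet_trivializationAt F E q.proj)
    refine e.injOn hps hqs (Prod.ext ?_ ?_)
    · exact (e.coe_fst hps).trans (hpq.trans (e.coe_fst hqs).symm)
    · refine β.ext_elem fun i => ?_
      have := h2 i (Finset.mem_univ i)
      rw [hpq, b.eq_one, one_mul] at this
      exact sub_eq_zero.1 (pow_eq_zero_iff two_ne_zero |>.1 this)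
  · rintro rfl
    change ρ p = 0
    rw [hρa, (ha0 p.proj).1 rfl, b.eq_one]
    simp

/-- A character of the algebra of smooth functions that agrees on `Pol` with the evaluation at a
point is that evaluation. -/
theorem eq_evalAt_of_eq_on_Pol [SecondCountableTopology M] [FiniteDimensional ℝ F]
    {χ : SmoothFun m F E →ₐ[ℝ] ℝ} {q : TotalSpace F E}
    (h : ∀ f : Pol m F E, χ f = (f : SmoothFun m F E) q) (f : SmoothFun m F E) : χ f = f q := by
  obtain ⟨ρ, hρ⟩ := exists_Pol_nonneg_eq_zero_iff m q
  -- `χ` kills `ρ` and `f - χ f`; the sum of `ρ` and a square vanishes only where both do.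
  obtain ⟨p, hp⟩ := exists_zero_of_map_eq_zero χ (f := (f - algebraMap ℝ _ (χ f)) ^ 2 + ρ)
    (by simp [h, ((hρ q).2).2 rfl])
  have hp' : (f p - χ f) ^ 2 + (ρ : SmoothFun m F E) p = 0 := by
    rw [← evalAt_apply (I := (𝓡 m).prod 𝓘(ℝ, F))] at hp
    simpa only [map_add, map_pow, map_sub, AlgHom.commutes, evalAt_apply,
      Algebra.algebraMap_self, RingHom.id_apply] using hp
  obtain ⟨h1, h2⟩ := (add_eq_zero_iff_of_nonneg (sq_nonneg _) (hρ p).1).1 hp'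
  rw [← (hρ p).2.1 h2]
  exact (sub_eq_zero.1 (pow_eq_zero_iff two_ne_zero |>.1 h1)).symm

/-- A homomorphism on smooth functions is determined by its restriction to `Pol`. -/
theorem algHom_ext_of_eq_on_Pol [SecondCountableTopology M] [FiniteDimensional ℝ F]
    {V : Type*} [NormedAddCommGroup V] [NormedSpace ℝ V] {H : Type*} [TopologicalSpace H]
    {I : ModelWithCorners ℝ V H} {N : Type*} [TopologicalSpace N] [ChartedSpace H N]
    {Φ Φ' : SmoothFun m F E →ₐ[ℝ] C^∞⟮I, N; ℝ⟯}
    (h : ∀ f : Pol m F E, Φ f = Φ' f) : Φ = Φ' := by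
  ext f y
  obtain ⟨q, hq⟩ := exists_eq_eval_of_Pol (((evalAt I y).comp Φ).comp (Pol m F E).val)
  exact (eq_evalAt_of_eq_on_Pol (χ := (evalAt I y).comp Φ) hq f).trans
    (eq_evalAt_of_eq_on_Pol (χ := (evalAt I y).comp Φ')
      (fun g => (congrArg (evalAt I y) (h g)).symm.trans (hq g)) f).symm

/-- A map into the total space is smooth if its composition with every fiberwise polynomial function
is. -/
theorem contMDiff_of_forall_Pol [FiniteDimensional ℝ F]
    {V : Type*} [NormedAddCommGroup V] [NormedSpace ℝ V] {H : Type*} [TopologicalSpace H]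
    {I : ModelWithCorners ℝ V H} {N : Type*} [TopologicalSpace N] [ChartedSpace H N]
    {φ : N → TotalSpace F E}
    (h : ∀ f : Pol m F E, ContMDiff I 𝓘(ℝ, ℝ) ∞ fun y => (f : SmoothFun m F E) (φ y)) :
    ContMDiff I ((𝓡 m).prod 𝓘(ℝ, F)) ∞ φ := by
  intro y
  have hbase : ∀ a : M → ℝ, ContMDiff (𝓡 m) 𝓘(ℝ, ℝ) ∞ a →
      ContMDiff I 𝓘(ℝ, ℝ) ∞ fun z => a (φ z).proj := fun a ha =>
    h ⟨_, mem_Pol_of_mem_PolHomogeneous (precomp_projMap_mem ⟨a, ha⟩)⟩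
  have hcont : ContinuousAt (fun z => (φ z).proj) y := by
    intro U hU
    obtain ⟨f, -, hf⟩ := (SmoothBumpFunction.nhds_basis_support (I := 𝓡 m) hU).mem_iff.1 hU
    have h1 := (hbase f f.contMDiff).continuous.continuousAt (x := y)
    have h2 : ∀ᶠ z in 𝓝 y, f (φ z).proj ≠ 0 := h1.eventually_ne (by simp)
    exact h2.mono fun z hz => hf hz
  rw [contMDiffAt_totalSpace]
  constructor
  · rw [contMDiffAt_iff_target]
    refine ⟨hcont, contMDiffAt_of_forall_clm fun l => ?_⟩
    obtain ⟨f⟩ : Nonempty (SmoothBumpFunction (𝓡 m) (φ y).proj) := inferInstance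
    have hl : ContMDiff (𝓡 m) 𝓘(ℝ, ℝ) ∞ fun z => f z • l (extChartAt (𝓡 m) (φ y).proj z) :=
      f.contMDiff_smul (l.contMDiff.comp_contMDiffOn
        (contMDiffOn_extChartAt (n := ∞) (I := 𝓡 m) (x := (φ y).proj)))
    refine (hbase _ hl).contMDiffAt.congr_of_eventuallyEq ?_
    filter_upwards [hcont.eventually f.eventuallyEq_one] with z hz
    simp [hz]
  · refine contMDiffAt_of_forall_clm fun l => ?_
    obtain ⟨b⟩ := Cutoff.nonempty (m := m) F E (φ y).proj
    refine (h ⟨_, mem_Pol_of_mem_PolHomogeneous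
      (b.fiberCoord_mem l)⟩).contMDiffAt.congr_of_eventuallyEq ?_
    filter_upwards [hcont.eventually b.eventually_eq_one] with z hz
    simp [Cutoff.fiberCoord_apply, hz]

/-- A homomorphism from `Pol` to smooth functions is the pullback along a smooth map, so it extends
to all smooth functions. -/
theorem exists_algHom_extension [SecondCountableTopology M] [FiniteDimensional ℝ F]
    {V : Type*} [NormedAddCommGroup V] [NormedSpace ℝ V] {H : Type*} [TopologicalSpace H]
    {I : ModelWithCorners ℝ V H} {N : Type*} [TopologicalSpace N] [ChartedSpace H N]
    (Ψ : Pol m F E →ₐ[ℝ] C^∞⟮I, N; ℝ⟯) :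
    ∃ Φ : SmoothFun m F E →ₐ[ℝ] C^∞⟮I, N; ℝ⟯, ∀ f : Pol m F E, Φ f = Ψ f := by
  choose φ hφ using fun y => exists_eq_eval_of_Pol ((evalAt I y).comp Ψ)
  have hsmooth : ContMDiff I ((𝓡 m).prod 𝓘(ℝ, F)) ∞ φ := contMDiff_of_forall_Pol fun f =>
    (Ψ f).contMDiff.congr fun y => (hφ y f).symm
  refine ⟨precomp ⟨φ, hsmooth⟩, fun f => ?_⟩
  ext y
  exact (hφ y f).symm

end Points

end FiberwisePolynomial

end

theorem mainTheorem6 {m : ℕ} {M : Type*} [TopologicalSpace M] [T2Space M]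
    [SecondCountableTopology M] [ConnectedSpace M]
    [ChartedSpace (EuclideanSpace ℝ (Fin m)) M] [IsManifold (𝓡 m) ∞ M]
    -- the vector bundle `π`, with fibers `E x` and typical fiber `F`
    {F : Type*} [NormedAddCommGroup F] [NormedSpace ℝ F] [FiniteDimensional ℝ F]
    {E : M → Type*} [∀ x, AddCommGroup (E x)] [∀ x, Module ℝ (E x)]
    [∀ x, TopologicalSpace (E x)] [TopologicalSpace (Bundle.TotalSpace F E)]
    [FiberBundle F E] [VectorBundle ℝ F E] [ContMDiffVectorBundle ∞ F E (𝓡 m)]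
    -- the vector bundle `η`, with fibers `E' x` and typical fiber `F'`
    {F' : Type*} [NormedAddCommGroup F'] [NormedSpace ℝ F'] [FiniteDimensional ℝ F']
    {E' : M → Type*} [∀ x, AddCommGroup (E' x)] [∀ x, Module ℝ (E' x)]
    [∀ x, TopologicalSpace (E' x)] [TopologicalSpace (Bundle.TotalSpace F' E')]
    [FiberBundle F' E'] [VectorBundle ℝ F' E'] [ContMDiffVectorBundle ∞ F' E' (𝓡 m)]
    (Ψ : FiberwisePolynomial.Pol m F E ≃ₐ[ℝ] FiberwisePolynomial.Pol m F' E') :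
    ∃ Ψbar : FiberwisePolynomial.SmoothFun m F E →ₐ[ℝ]
        FiberwisePolynomial.SmoothFun m F' E',
      (∀ f : FiberwisePolynomial.Pol m F E,
        Ψbar (f : FiberwisePolynomial.SmoothFun m F E) =
          (Ψ f : FiberwisePolynomial.SmoothFun m F' E')) ∧
      (∀ Φ : FiberwisePolynomial.SmoothFun m F E →ₐ[ℝ]
          FiberwisePolynomial.SmoothFun m F' E',
        (∀ f : FiberwisePolynomial.Pol m F E,
          Φ (f : FiberwisePolynomial.SmoothFun m F E) =
            (Ψ f : FiberwisePolynomial.SmoothFun m F' E')) → Φ = Ψbar) ∧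
      Function.Bijective Ψbar := by
  obtain ⟨Φ, hΦ⟩ := FiberwisePolynomial.exists_algHom_extension
    ((FiberwisePolynomial.Pol m F' E').val.comp Ψ.toAlgHom)
  obtain ⟨Φ', hΦ'⟩ := FiberwisePolynomial.exists_algHom_extension
    ((FiberwisePolynomial.Pol m F E).val.comp Ψ.symm.toAlgHom)
  replace hΦ : ∀ f : FiberwisePolynomial.Pol m F E, Φ f = Ψ f := hΦ
  replace hΦ' : ∀ f : FiberwisePolynomial.Pol m F' E', Φ' f = Ψ.symm f := hΦ'
  -- The extensions of `Ψ` and of its inverse are mutually inverse, as both compositions extend an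
  -- identity.
  have h1 : Φ'.comp Φ = AlgHom.id ℝ _ :=
    FiberwisePolynomial.algHom_ext_of_eq_on_Pol fun f => by simp [hΦ, hΦ']
  have h2 : Φ.comp Φ' = AlgHom.id ℝ _ :=
    FiberwisePolynomial.algHom_ext_of_eq_on_Pol fun f => by simp [hΦ, hΦ']
  refine ⟨Φ, hΦ, fun Θ hΘ => ?_, Function.bijective_iff_has_inverse.2 ⟨Φ', ?_, ?_⟩⟩
  · exact FiberwisePolynomial.algHom_ext_of_eq_on_Pol fun f => (hΘ f).trans (hΦ f).symm
  · exact DFunLike.congr_fun h1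
  · exact DFunLike.congr_fun h2
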